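/- Let $G$ be a finite connected simple cubic plane graph, the embedding being given (up to homeomorphism) by the cyclic orders of the edges at the vertices, i.e. by a rotation system of $G$ with $|V|-|E|+|F|=2$, where the faces are the closed boundary walks determined by the rotation system. The size of a face is the length of its boundary walk. A distance-two four-coloring of $G$ is an assignment of one of four colors to each vertex such that, for every vertex $v$, the colors of $v$ and of all its neighbors are pairwise distinct. Then $G$ has a distance-two four-coloring in which exactly three colors appear on the vertices of each face if and only if the following three conditions hold: 1. the size of every face of $G$ is a multiple of $3$; 2. $G$ is bi-connected (it has at least three vertices, is connected, and remains connected after the deletion of any single vertex); 3. if two distinct faces $F_1, F_2$ share two distinct edges $e, e'$, then the relative positions of $e, e'$ in the two faces are congruent modulo $3$: whenever there are $n_1$ edges strictly between $e$ and $e'$ in a traversal of $F_1$ (walking from $e$ to $e'$, less than once around, along the boundary walk in either of its two directions) and $n_2$ edges strictly between $e$ and $e'$ in a traversal of $F_2$ (likewise), then $n_1 \equiv n_2 \pmod 3$. -/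

import Mathlib

/-- A rotation system on a simple graph (a combinatorial embedding in an oriented closed surface):
for every vertex `v`, the darts (directed edges) leaving `v` are arranged in one cyclic order;
`rot d` is the dart that follows `d` in the cyclic order at the tail of `d`. -/
structure RotationSystem {V : Type*} (G : SimpleGraph V) where
  rot : Equiv.Perm G.Dart
  fst_rot : ∀ d : G.Dart, (rot d).fst = d.fst
  sameCycle_of_fst_eq : ∀ d d' : G.Dart, d.fst = d'.fst → rot.SameCycle d d'

namespace RotationSystem

variable {V : Type*} {G : SimpleGraph V}

/-- One step of the walk along the boundary of a face, keeping the face on a fixed side: traverse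
the dart `d` and leave its head by the dart following the reversal of `d` in the rotation. -/
def facePerm (M : RotationSystem G) : Equiv.Perm G.Dart :=
  (SimpleGraph.Dart.symm_involutive (G := G)).toPerm.trans M.rot

/-- The faces are the orbits of darts under the face step; the darts in an orbit
form the closed boundary walk of the face. -/
def Face (M : RotationSystem G) : Type _ :=
  Quotient (Equiv.Perm.SameCycle.setoid M.facePerm)

/-- The face whose boundary walk contains the dart `d`. -/
def faceOf (M : RotationSystem G) (d : G.Dart) : M.Face :=
  Quotient.mk (Equiv.Perm.SameCycle.setoid M.facePerm) d

/-- The size of a face: the length of its boundary walk. -/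
noncomputable def faceSize (M : RotationSystem G) (F : M.Face) : ℕ :=
  {d : G.Dart | M.faceOf d = F}.ncard

/-- The set of vertices on the boundary of a face. -/
def faceVertices (M : RotationSystem G) (F : M.Face) : Set V :=
  {v | ∃ d : G.Dart, M.faceOf d = F ∧ d.fst = v}

/-- There are `n` edges strictly between the edges `e` and `e'` in some traversal of `F`: walking
along the boundary of `F` (less than once around) in one of its two directions from `e` to `e'`,
one meets exactly `n` edges after `e` and before `e'`. -/
def EdgesBetween (M : RotationSystem G) (F : M.Face) (e e' : Sym2 V) (n : ℕ) : Prop :=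
  ∃ step : Equiv.Perm G.Dart, (step = M.facePerm ∨ step = M.facePerm⁻¹) ∧
    ∃ d : G.Dart, M.faceOf d = F ∧ n + 1 < M.faceSize F ∧
      d.edge = e ∧ ((step ^ (n + 1)) d).edge = e'

/-- Shared edges have congruent relative positions: whenever two different faces share two different
edges `e`, `e'`, and there are `n₁` edges between `e` and `e'` in some traversal of the first face
and `n₂` edges between them in some traversal of the second one, then `n₁ ≡ n₂` modulo `3`. -/
def SharedEdgesCongruent (M : RotationSystem G) : Prop :=
  ∀ F₁ F₂ : M.Face, F₁ ≠ F₂ → ∀ e e' : Sym2 V, e ≠ e' → ∀ n₁ n₂ : ℕ,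
    M.EdgesBetween F₁ e e' n₁ → M.EdgesBetween F₂ e e' n₂ → n₁ ≡ n₂ [MOD 3]

end RotationSystem

/-- An embedding of a finite connected graph (with at least one edge) in the plane, or equivalently
in the sphere, given by the cyclic orders of the edges at the vertices: a rotation system of
genus zero, that is, with `|V| - |E| + |F| = 2`. -/
structure PlaneEmbedding {V : Type*} (G : SimpleGraph V) extends RotationSystem G where
  euler : (Nat.card V : ℤ) - Nat.card G.edgeSet + Nat.card toRotationSystem.Face = 2

/-- A distance-two coloring: at every vertex, the colors of the vertex and of all its neighbors
are pairwise distinct. -/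
def IsDistanceTwoColoring {V C : Type*} (G : SimpleGraph V) (c : V → C) : Prop :=
  ∀ v : V, Set.InjOn c (insert v (G.neighborSet v))

/-- A graph is bi-connected (2-connected) if it has at least three vertices, is connected, and
remains connected when any one vertex is deleted. -/
def IsBiconnected {V : Type*} (G : SimpleGraph V) : Prop :=
  3 ≤ Nat.card V ∧ G.Connected ∧ ∀ v : V, (G.induce ({v}ᶜ : Set V)).Connected

namespace Equiv.Perm

/-! Necessity: consecutive triples on a face walk already have distinct colours, so three colours on
a face force period three along its walk (`color_fst_facePerm_pow_three`), and face sizes are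
divisible by three. An edge with one face on both sides would be read in both directions within one
periodic sequence, so there is none (`IsFacePeriodic.faceOf_symm_ne`). Face walks then visit each
vertex only once and give detours around a deleted vertex (`isBiconnected_of_faceOf_symm_ne`). Edges
shared by two faces carry the same colours in the same order (`IsFacePeriodic.color_eq_of_shared`),
which gives the congruences.

Sufficiency: Euler's formula and a dimension count show that an antisymmetric function on darts with
zero face sums is a gradient (`PlaneEmbedding.exists_potential`). Over `ZMod 3`, divisible face
sizes allow labels increasing around each vertex to be shifted until they agree across edges. Over
`ZMod 2`, turning these labels into the nonzero vectors of the Klein four-group gives zero face sums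
again, and the resulting potential is the colouring. -/

theorem ncard_sameCycle {α : Type*} [Finite α] (σ : Perm α) (x : α) :
    {y | σ.SameCycle x y}.ncard = Function.minimalPeriod σ x := by
  classical
  have := Fintype.ofFinite α
  have h : {y | σ.SameCycle x y} = MulAction.orbit (Subgroup.zpowers σ) x := by
    ext y
    constructor
    · rintro ⟨n, hn⟩
      exact ⟨⟨σ ^ n, n, rfl⟩, hn⟩
    · rintro ⟨⟨_, n, rfl⟩, hn⟩
      exact ⟨n, hn⟩
  rw [h, ← Nat.card_coe_set_eq, Nat.card_eq_fintype_card, ← MulAction.minimalPeriod_eq_card]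
  rfl

theorem pow_apply_eq_self_iff_minimalPeriod_dvd {α : Type*} (σ : Perm α) (x : α) (n : ℕ) :
    (σ ^ n) x = x ↔ Function.minimalPeriod σ x ∣ n := by
  rw [← Function.isPeriodicPt_iff_minimalPeriod_dvd, Function.IsPeriodicPt, Function.IsFixedPt,
    Equiv.Perm.iterate_eq_pow]

end Equiv.Perm

/-! ### Faces and vertices as cycles of permutations of the darts. -/

namespace RotationSystem

variable {V : Type*} {G : SimpleGraph V}

theorem facePerm_apply (M : RotationSystem G) (d : G.Dart) : M.facePerm d = M.rot d.symm := rfl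

theorem fst_facePerm (M : RotationSystem G) (d : G.Dart) : (M.facePerm d).fst = d.snd :=
  M.fst_rot d.symm

theorem faceOf_eq_iff (M : RotationSystem G) {d d' : G.Dart} :
    M.faceOf d = M.faceOf d' ↔ M.facePerm.SameCycle d d' :=
  Quotient.eq (r := Equiv.Perm.SameCycle.setoid M.facePerm)

theorem faceOf_facePerm (M : RotationSystem G) (d : G.Dart) :
    M.faceOf (M.facePerm d) = M.faceOf d := by
  rw [faceOf_eq_iff, Equiv.Perm.sameCycle_apply_left]

theorem faceOf_facePerm_pow (M : RotationSystem G) (n : ℕ) (d : G.Dart) :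
    M.faceOf ((M.facePerm ^ n) d) = M.faceOf d := by
  rw [faceOf_eq_iff, Equiv.Perm.sameCycle_pow_left]

theorem exists_faceOf_eq (M : RotationSystem G) (F : M.Face) : ∃ d, M.faceOf d = F :=
  Quotient.exists_rep F

theorem faceOf_rot (M : RotationSystem G) (d : G.Dart) :
    M.faceOf (M.rot d) = M.faceOf d.symm := by
  rw [← faceOf_facePerm M d.symm, facePerm_apply, SimpleGraph.Dart.symm_symm]

instance [Finite V] : Finite G.Dart :=
  Finite.of_injective _ (SimpleGraph.Dart.toProd_injective (G := G))

instance [Finite V] (M : RotationSystem G) : Finite M.Face :=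
  inferInstanceAs (Finite (Quotient _))

theorem faceSize_faceOf [Finite V] (M : RotationSystem G) (d : G.Dart) :
    M.faceSize (M.faceOf d) = Function.minimalPeriod M.facePerm d := by
  rw [← Equiv.Perm.ncard_sameCycle, faceSize]
  congr 1
  ext d'
  rw [Set.mem_ofPred_eq, Set.mem_ofPred_eq, faceOf_eq_iff, Equiv.Perm.sameCycle_comm]

theorem exists_facePerm_pow_eq [Finite V] (M : RotationSystem G) {d d' : G.Dart}
    (h : M.faceOf d = M.faceOf d') : ∃ n : ℕ, (M.facePerm ^ n) d = d' :=
  have ⟨n, _, hn⟩ := ((M.faceOf_eq_iff).1 h).exists_pow_eq'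
  ⟨n, hn⟩

theorem sameCycle_rot_iff (M : RotationSystem G) {d d' : G.Dart} :
    M.rot.SameCycle d d' ↔ d.fst = d'.fst := by
  refine ⟨?_, M.sameCycle_of_fst_eq d d'⟩
  have key : ∀ (n : ℕ) d, ((M.rot ^ n) d).fst = d.fst := by
    intro n
    induction n with
    | zero => simp
    | succ n ih => intro d; rw [pow_succ, Equiv.Perm.mul_apply, ih, M.fst_rot]
  rintro ⟨n, rfl⟩
  obtain ⟨n, rfl | rfl⟩ := n.eq_nat_or_neg
  · rw [zpow_natCast, key]
  · have := key n ((M.rot ^ (-(n : ℤ))) d)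
    rw [← this, ← zpow_natCast, ← Equiv.Perm.mul_apply, ← zpow_add, add_neg_cancel, zpow_zero,
      Equiv.Perm.one_apply]

section Cubic

variable [Finite V] [G.LocallyFinite]

theorem minimalPeriod_rot (M : RotationSystem G) (hcubic : G.IsRegularOfDegree 3)
    (d : G.Dart) : Function.minimalPeriod M.rot d = 3 := by
  rw [← Equiv.Perm.ncard_sameCycle]
  have : {y | M.rot.SameCycle d y} = Set.range (G.dartOfNeighborSet d.fst) := by
    ext y
    rw [Set.mem_ofPred_eq, sameCycle_rot_iff]
    constructor
    · intro h
      exact ⟨⟨y.snd, h ▸ y.adj⟩, SimpleGraph.Dart.ext _ _ (Prod.ext h rfl)⟩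
    · rintro ⟨w, rfl⟩
      rfl
  rw [this, ← Nat.card_coe_set_eq,
    Nat.card_range_of_injective (G.dartOfNeighborSet_injective d.fst), Nat.card_eq_fintype_card,
    G.card_neighborSet_eq_degree, hcubic]

theorem rot_pow_apply_eq_iff (M : RotationSystem G) (hcubic : G.IsRegularOfDegree 3)
    (d : G.Dart) (m n : ℕ) : (M.rot ^ m) d = (M.rot ^ n) d ↔ m ≡ n [MOD 3] := by
  have hp := M.minimalPeriod_rot hcubic d
  rw [← Equiv.Perm.iterate_eq_pow, ← Equiv.Perm.iterate_eq_pow,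
    ← Function.iterate_mod_minimalPeriod_eq (n := m),
    ← Function.iterate_mod_minimalPeriod_eq (n := n),
    Function.iterate_eq_iterate_iff_of_lt_minimalPeriod
      (by rw [hp]; exact Nat.mod_lt _ (by norm_num))
      (by rw [hp]; exact Nat.mod_lt _ (by norm_num)), hp, Nat.ModEq]

theorem rot_apply_ne (M : RotationSystem G) (hcubic : G.IsRegularOfDegree 3) (d : G.Dart) :
    M.rot d ≠ d := fun h => by
  simpa [Nat.ModEq] using (M.rot_pow_apply_eq_iff hcubic d 1 0).1 (by simpa using h)

theorem rot_rot_apply_ne (M : RotationSystem G) (hcubic : G.IsRegularOfDegree 3) (d : G.Dart) :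
    M.rot (M.rot d) ≠ d := fun h => by
  simpa [Nat.ModEq] using (M.rot_pow_apply_eq_iff hcubic d 2 0).1 (by simpa [pow_two] using h)

end Cubic

/-- A function on darts that is invariant under rotation and reversal is constant. -/
theorem eq_of_rot_of_symm (M : RotationSystem G) (hconn : G.Connected) {X : Type*}
    (f : G.Dart → X) (hrot : ∀ d, f (M.rot d) = f d) (hsymm : ∀ d, f d.symm = f d)
    (d d' : G.Dart) : f d = f d' := by
  have hpow : ∀ (n : ℕ) d, f ((M.rot ^ n) d) = f d := by
    intro n
    induction n with
    | zero => simp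
    | succ n ih => intro d; rw [pow_succ, Equiv.Perm.mul_apply, ih, hrot]
  have hfst : ∀ d d' : G.Dart, d.fst = d'.fst → f d = f d' := by
    intro d d' h
    obtain ⟨n, rfl⟩ := M.sameCycle_of_fst_eq d d' h
    obtain ⟨n, rfl | rfl⟩ := n.eq_nat_or_neg
    · rw [zpow_natCast, hpow]
    · rw [← hpow n ((M.rot ^ (-(n : ℤ))) d), ← zpow_natCast, ← Equiv.Perm.mul_apply, ← zpow_add,
        add_neg_cancel, zpow_zero, Equiv.Perm.one_apply]
  obtain ⟨w⟩ := hconn.preconnected d.fst d'.fst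
  have : ∀ (u v : V) (w : G.Walk u v) (d d' : G.Dart), d.fst = u → d'.fst = v → f d = f d' := by
    intro u v w
    induction w with
    | nil => intro d d' h h'; exact hfst d d' (h.trans h'.symm)
    | cons h p ih =>
      intro d d' hd hd'
      let e : G.Dart := ⟨(_, _), h⟩
      rw [hfst d e hd, ← hsymm e]
      exact ih _ _ rfl hd'
  exact this _ _ w d d' rfl rfl

/-! ### Vanishing of the first cohomology of the sphere. -/

section Cohomology

variable (k : Type*) [Field k]

/-- The coboundary of a potential on the vertices, a function on darts. -/
def gradient (G : SimpleGraph V) : (V → k) →ₗ[k] (G.Dart → k) where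
  toFun p d := p d.snd - p d.fst
  map_add' p q := by ext d; simp only [Pi.add_apply]; ring
  map_smul' a p := by ext d; simp only [Pi.smul_apply, smul_eq_mul, RingHom.id_apply]; ring

/-- The functions on darts that change sign under reversal. -/
def antisymmetric (G : SimpleGraph V) : Submodule k (G.Dart → k) where
  carrier := {x | ∀ d, x d.symm = -x d}
  add_mem' hx hy d := by simp only [Pi.add_apply, hx d, hy d]; ring
  zero_mem' d := by simp
  smul_mem' a x hx d := by simp only [Pi.smul_apply, hx d, smul_neg]

open Classical in
/-- The sum of a function on darts over the boundary walk of each face. -/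
noncomputable def faceSum (M : RotationSystem G) [Fintype G.Dart] :
    (G.Dart → k) →ₗ[k] (M.Face → k) where
  toFun x F := ∑ d, if M.faceOf d = F then x d else 0
  map_add' x y := by
    ext F
    simp only [Pi.add_apply, ← Finset.sum_add_distrib]
    exact Finset.sum_congr rfl fun d _ => by split_ifs <;> simp
  map_smul' a x := by
    ext F
    simp only [Pi.smul_apply, RingHom.id_apply, smul_eq_mul, Finset.mul_sum, mul_ite, mul_zero]

variable {k}

theorem faceSum_comp_facePerm (M : RotationSystem G) [Fintype G.Dart] (x : G.Dart → k) :
    M.faceSum k (fun d => x (M.facePerm d)) = M.faceSum k x := by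
  classical
  ext F
  simp only [faceSum, LinearMap.coe_mk, AddHom.coe_mk]
  rw [← Equiv.sum_comp M.facePerm fun d => if M.faceOf d = F then x d else 0]
  simp only [faceOf_facePerm]

/-- The sum telescopes around the closed walk: the head of a dart is the tail of its face successor.
-/
theorem faceSum_gradient (M : RotationSystem G) [Fintype G.Dart] (p : V → k) :
    M.faceSum k (gradient k G p) = 0 := by
  have : gradient k G p =
      (fun d => (fun d : G.Dart => p d.fst) (M.facePerm d)) - fun d : G.Dart => p d.fst := by
    ext d
    simp [gradient, fst_facePerm]
  rw [this, map_sub, faceSum_comp_facePerm M fun d : G.Dart => p d.fst, sub_self]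

theorem gradient_mem_antisymmetric (p : V → k) : gradient k G p ∈ antisymmetric k G := by
  intro d
  simp [gradient]

/-- One chosen dart per edge determines an antisymmetric function. -/
theorem finrank_antisymmetric_le [Finite V] :
    Module.finrank k (antisymmetric k G) ≤ Nat.card G.edgeSet := by
  classical
  have := Fintype.ofFinite V
  choose s hs using fun e : G.edgeSet => (by
    obtain ⟨⟨a, b⟩, h⟩ := e
    exact ⟨⟨(a, b), h⟩, rfl⟩ : ∃ d : G.Dart, d.edge = e)
  let φ : antisymmetric k G →ₗ[k] (G.edgeSet → k) :=
    (LinearMap.funLeft k k s).comp (antisymmetric k G).subtype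
  have hφ : Function.Injective φ := by
    rw [injective_iff_map_eq_zero]
    rintro ⟨x, hx⟩ h
    ext d
    have h1 : x (s ⟨d.edge, d.edge_mem⟩) = 0 := congrFun h _
    rcases SimpleGraph.dart_edge_eq_iff _ _ |>.1 (hs ⟨d.edge, d.edge_mem⟩) with h2 | h2
    · rw [h2] at h1
      exact h1
    · rw [h2, hx] at h1
      exact neg_eq_zero.1 h1
  refine (LinearMap.finrank_le_finrank_of_injective hφ).trans ?_
  rw [Module.finrank_fintype_fun_eq_card, Nat.card_eq_fintype_card]

/-- By connectedness only constants have zero gradient; the bound is rank-nullity. -/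
theorem card_le_finrank_range_gradient_add_one [Finite V] (hconn : G.Connected) :
    Nat.card V ≤ Module.finrank k (LinearMap.range (gradient k G)) + 1 := by
  have := Fintype.ofFinite V
  have h := LinearMap.finrank_range_add_finrank_ker (gradient k G)
  rw [Module.finrank_fintype_fun_eq_card, ← Nat.card_eq_fintype_card] at h
  have hker : Module.finrank k (LinearMap.ker (gradient k G)) ≤ 1 := by
    have h1 : (1 : V → k) ∈ LinearMap.ker (gradient k G) := by
      rw [LinearMap.mem_ker]
      ext d
      simp [gradient]
    refine finrank_le_one ⟨1, h1⟩ ?_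
    rintro ⟨p, hp⟩
    obtain ⟨v⟩ := hconn.nonempty
    refine ⟨p v, Subtype.ext ?_⟩
    have hadj : ∀ u w, G.Adj u w → p u = p w := by
      intro u w huw
      exact (sub_eq_zero.1 (congrFun (LinearMap.mem_ker.1 hp) ⟨(u, w), huw⟩)).symm
    ext u
    obtain ⟨w⟩ := hconn.preconnected v u
    have : p v = p u := by
      induction w with
      | nil => rfl
      | cons h _ ih => exact (hadj _ _ h).trans ih
    simp [this]
  omega

/-- Modulo face sums of antisymmetric functions, the indicators of the two faces along an edge
agree. By connectedness all faces have the same class, so the cokernel has dimension at most one. -/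
theorem card_face_le_finrank_add_one [Finite V] (M : RotationSystem G) [Fintype G.Dart]
    (hconn : G.Connected) :
    Nat.card M.Face ≤
      Module.finrank k ((antisymmetric k G).map (M.faceSum k)) + 1 := by
  classical
  have := Fintype.ofFinite M.Face
  set R := (antisymmetric k G).map (M.faceSum k)
  have h := Submodule.finrank_quotient_add_finrank R
  rw [Module.finrank_fintype_fun_eq_card, ← Nat.card_eq_fintype_card] at h
  suffices Module.finrank k ((M.Face → k) ⧸ R) ≤ 1 by omega
  let f : G.Dart → (M.Face → k) ⧸ R := fun d => R.mkQ (Pi.single (M.faceOf d) 1)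
  have hsymm : ∀ d, f d.symm = f d := by
    intro d
    refine (Submodule.Quotient.eq R).2 ?_
    refine ⟨Pi.single d.symm 1 - Pi.single d 1, ?_, ?_⟩
    · intro e
      have h1 : e.symm = d ↔ e = d.symm := by
        constructor <;> rintro rfl <;> simp
      have h2 : e.symm = d.symm ↔ e = d := by
        rw [(SimpleGraph.Dart.symm_involutive (G := G)).injective.eq_iff]
      simp [Pi.single_apply, h1, h2]
    · ext F
      have hs : ∀ e : G.Dart, M.faceSum k (Pi.single e 1) F = if M.faceOf e = F then 1 else 0 := by
        intro e
        simp only [faceSum, LinearMap.coe_mk, AddHom.coe_mk]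
        rw [Finset.sum_eq_single e (fun e' _ he' => by simp [he']) (by simp), Pi.single_eq_same]
      rw [map_sub, Pi.sub_apply, hs, hs]
      simp only [Pi.sub_apply, Pi.single_apply, eq_comm]
  have hrot : ∀ d, f (M.rot d) = f d := by
    intro d
    rw [← hsymm d]
    simp only [f, faceOf_rot]
  have hconst := M.eq_of_rot_of_symm hconn f hrot hsymm
  rcases isEmpty_or_nonempty M.Face with _ | ⟨⟨F⟩⟩
  · rw [Module.finrank_zero_of_subsingleton]
    exact zero_le_one
  obtain ⟨d, rfl⟩ := M.exists_faceOf_eq F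
  refine finrank_le_one (f d) fun w => ?_
  obtain ⟨y, rfl⟩ := R.mkQ_surjective w
  refine ⟨∑ F, y F, ?_⟩
  conv_rhs => rw [← Finset.univ_sum_single y]
  rw [map_sum, Finset.sum_smul]
  refine Finset.sum_congr rfl fun F _ => ?_
  obtain ⟨d', rfl⟩ := M.exists_faceOf_eq F
  rw [hconst d d']
  simp only [f]
  rw [← map_smul, ← Pi.single_smul, smul_eq_mul, mul_one]

/-- On a sphere the first cohomology vanishes. -/
theorem _root_.PlaneEmbedding.exists_potential [Finite V] [Fintype G.Dart] (M : PlaneEmbedding G)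
    (hconn : G.Connected) (x : G.Dart → k) (hx : ∀ d, x d.symm = -x d)
    (hsum : M.faceSum k x = 0) : ∃ p : V → k, ∀ d : G.Dart, x d = p d.snd - p d.fst := by
  let S := (M.faceSum k).domRestrict (antisymmetric k G)
  have h1 := LinearMap.finrank_range_add_finrank_ker S
  have hrange : LinearMap.range S = (antisymmetric k G).map (M.faceSum k) :=
    LinearMap.range_domRestrict _ _
  have h2 := card_face_le_finrank_add_one (k := k) M.toRotationSystem hconn
  have h3 := finrank_antisymmetric_le (k := k) (G := G)
  have h4 := card_le_finrank_range_gradient_add_one (k := k) hconn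
  have h5 := M.euler
  rw [hrange] at h1
  let Z := (LinearMap.ker S).map (antisymmetric k G).subtype
  have h6 : Module.finrank k Z = Module.finrank k (LinearMap.ker S) :=
    (Submodule.equivMapOfInjective _ (Submodule.subtype_injective _) _).finrank_eq.symm
  have hle : LinearMap.range (gradient k G) ≤ Z := by
    rintro _ ⟨p, rfl⟩
    exact ⟨⟨_, gradient_mem_antisymmetric p⟩, M.faceSum_gradient p, rfl⟩
  -- By rank-nullity, `Z` has dimension at most |E| - (|F| - 1) = |V| - 1, which the gradients
  -- already attain.
  have hmem : x ∈ LinearMap.range (gradient k G) := by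
    rw [Submodule.eq_of_le_of_finrank_le hle (by omega)]
    exact ⟨⟨x, hx⟩, hsum, rfl⟩
  obtain ⟨p, rfl⟩ := hmem
  exact ⟨p, fun d => rfl⟩

end Cohomology

theorem snd_ne_of_ne {d d' : G.Dart} (h : d ≠ d') (hfst : d.fst = d'.fst) : d.snd ≠ d'.snd :=
  fun hsnd => h (SimpleGraph.Dart.ext _ _ (Prod.ext hfst hsnd))

theorem _root_.IsDistanceTwoColoring.ne_of_adj {C : Type*} {c : V → C}
    (hc : IsDistanceTwoColoring G c) {u v : V} (h : G.Adj u v) : c u ≠ c v :=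
  fun e => h.ne (hc u (Set.mem_insert _ _) (Set.mem_insert_of_mem _ h) e)

theorem _root_.IsDistanceTwoColoring.snd_ne {C : Type*} {c : V → C}
    (hc : IsDistanceTwoColoring G c) {d d' : G.Dart} (h : d ≠ d') (hfst : d.fst = d'.fst) :
    c d.snd ≠ c d'.snd := by
  refine fun e => snd_ne_of_ne h hfst
    (hc d.fst (Set.mem_insert_of_mem _ d.adj) (Set.mem_insert_of_mem _ ?_) e)
  rw [hfst]
  exact d'.adj

/-! ### Colourings with period three along faces. -/

section FacePeriodic

variable (M : RotationSystem G) {C : Type*} {c : V → C}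

theorem color_fst_ne_facePerm (hc : IsDistanceTwoColoring G c) (d : G.Dart) :
    c (M.facePerm d).fst ≠ c d.fst := by
  rw [fst_facePerm]
  exact (hc.ne_of_adj d.adj).symm

/-- A coloring of the vertices whose values along every boundary walk are periodic with
period three, any three consecutive values being distinct. -/
structure IsFacePeriodic (M : RotationSystem G) (c : V → C) : Prop where
  coloring : IsDistanceTwoColoring G c
  periodic : ∀ d, c (M.facePerm (M.facePerm (M.facePerm d))).fst = c d.fst

variable {M}

theorem IsFacePeriodic.color_mod (h : M.IsFacePeriodic c) (d : G.Dart) (n : ℕ) :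
    c ((M.facePerm ^ n) d).fst = c ((M.facePerm ^ (n % 3)) d).fst := by
  have key : ∀ q r : ℕ, c ((M.facePerm ^ (r + 3 * q)) d).fst = c ((M.facePerm ^ r) d).fst := by
    intro q r
    induction q with
    | zero => simp
    | succ q ih =>
      rw [show r + 3 * (q + 1) = (r + 3 * q) + 1 + 1 + 1 by ring, pow_succ', pow_succ', pow_succ']
      simp only [Equiv.Perm.mul_apply]
      rw [h.periodic, ih]
  conv_lhs => rw [← Nat.mod_add_div n 3]
  exact key _ _

theorem IsFacePeriodic.exists_lt_three (h : M.IsFacePeriodic c) (d : G.Dart) (n : ℕ) :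
    (n % 3 = 0 ∧ c ((M.facePerm ^ n) d).fst = c d.fst) ∨
    (n % 3 = 1 ∧ c ((M.facePerm ^ n) d).fst = c d.snd) ∨
    (n % 3 = 2 ∧ c ((M.facePerm ^ n) d).fst = c (M.facePerm d).snd) := by
  rw [h.color_mod]
  have : n % 3 = 0 ∨ n % 3 = 1 ∨ n % 3 = 2 := by omega
  rcases this with e | e | e <;> rw [e] <;> simp [pow_two, fst_facePerm]

end FacePeriodic

/-! ### From a colouring to the three conditions. -/

section Necessity

variable [Finite V] [G.LocallyFinite] (M : RotationSystem G) {C : Type*} {c : V → C}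

theorem color_fst_ne_facePerm_facePerm (hcubic : G.IsRegularOfDegree 3)
    (hc : IsDistanceTwoColoring G c) (d : G.Dart) :
    c (M.facePerm (M.facePerm d)).fst ≠ c d.fst := by
  rw [fst_facePerm, facePerm_apply]
  exact hc.snd_ne (M.rot_apply_ne hcubic d.symm) (M.fst_rot _)

theorem color_fst_facePerm_pow_three (hcubic : G.IsRegularOfDegree 3)
    (hc : IsDistanceTwoColoring G c)
    (h3 : ∀ F, (c '' M.faceVertices F).ncard = 3) (d : G.Dart) :
    c (M.facePerm (M.facePerm (M.facePerm d))).fst = c d.fst := by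
  set f := M.facePerm
  have h01 := M.color_fst_ne_facePerm hc d
  have h12 := M.color_fst_ne_facePerm hc (f d)
  have h23 := M.color_fst_ne_facePerm hc (f (f d))
  have h02 := M.color_fst_ne_facePerm_facePerm hcubic hc d
  have h13 := M.color_fst_ne_facePerm_facePerm hcubic hc (f d)
  have hmem : ∀ e, M.faceOf e = M.faceOf d → c e.fst ∈ c '' M.faceVertices (M.faceOf d) :=
    fun e he => ⟨_, ⟨e, he, rfl⟩, rfl⟩
  have hsub : ({c d.fst, c (f d).fst, c (f (f d)).fst} : Set C) ⊆
      c '' M.faceVertices (M.faceOf d) := by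
    rintro _ (rfl | rfl | rfl)
    · exact hmem _ rfl
    · exact hmem _ (M.faceOf_facePerm d)
    · exact hmem _ (by rw [faceOf_facePerm, faceOf_facePerm])
  have heq := Set.eq_of_subset_of_ncard_le hsub (by
    rw [h3, Set.ncard_eq_three.2 ⟨_, _, _, h01.symm, h02.symm, h12.symm, rfl⟩])
    (Set.toFinite _)
  have := hmem (f (f (f d))) (by simp only [f, faceOf_facePerm])
  rw [← heq] at this
  rcases this with h | h | h
  · exact h
  · exact absurd h h13
  · exact absurd h h23

variable {M}

theorem snd_facePerm_ne (hcubic : G.IsRegularOfDegree 3) (h : IsDistanceTwoColoring G c)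
    (d : G.Dart) : c (M.facePerm d).snd ≠ c d.fst ∧ c (M.facePerm d).snd ≠ c d.snd := by
  rw [← M.fst_facePerm (M.facePerm d)]
  refine ⟨M.color_fst_ne_facePerm_facePerm hcubic h d, ?_⟩
  rw [← M.fst_facePerm d]
  exact M.color_fst_ne_facePerm h _

theorem IsFacePeriodic.color_eq_iff (hcubic : G.IsRegularOfDegree 3) (h : M.IsFacePeriodic c)
    (d : G.Dart) (n : ℕ) : c ((M.facePerm ^ n) d).fst = c d.fst ↔ 3 ∣ n := by
  obtain ⟨h2, h3⟩ := snd_facePerm_ne (M := M) hcubic h.coloring d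
  have h1 := h.coloring.ne_of_adj d.adj
  rcases h.exists_lt_three d n with ⟨e, h'⟩ | ⟨e, h'⟩ | ⟨e, h'⟩ <;> rw [h'] <;>
    simp only [h1.symm, h2] <;> simp <;> omega

theorem IsFacePeriodic.three_dvd_faceSize (hcubic : G.IsRegularOfDegree 3)
    (h : M.IsFacePeriodic c) (F : M.Face) : 3 ∣ M.faceSize F := by
  obtain ⟨d, rfl⟩ := M.exists_faceOf_eq F
  rw [faceSize_faceOf, ← h.color_eq_iff hcubic d,
    (Equiv.Perm.pow_apply_eq_self_iff_minimalPeriod_dvd _ _ _).2 dvd_rfl]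

/-- Along a face the successor of a colour is determined. The dart `d` passes from one colour to
another and its reversal passes back, which no sequence of three distinct repeating colours allows.
-/
theorem IsFacePeriodic.faceOf_symm_ne (hcubic : G.IsRegularOfDegree 3)
    (h : M.IsFacePeriodic c) (d : G.Dart) : M.faceOf d.symm ≠ M.faceOf d := by
  intro hF
  obtain ⟨n, hn⟩ := M.exists_facePerm_pow_eq hF.symm
  obtain ⟨h2, h3⟩ := snd_facePerm_ne (M := M) hcubic h.coloring d
  have h1 := h.coloring.ne_of_adj d.adj
  have hfst : c ((M.facePerm ^ n) d).fst = c d.snd := by rw [hn]; rfl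
  have hsnd : c ((M.facePerm ^ (n + 1)) d).fst = c d.fst := by
    rw [pow_succ', Equiv.Perm.mul_apply, hn, fst_facePerm]
    rfl
  have h4 := (h.color_eq_iff hcubic d _).1 hsnd
  rcases h.exists_lt_three d n with ⟨e, h'⟩ | ⟨e, h'⟩ | ⟨e, h'⟩
  · omega
  · omega
  · exact h3 (h'.symm.trans hfst)

/-- The third color of a face does not occur on the face across any of its edges with the first
two colors. -/
theorem IsFacePeriodic.color_ne_of_faceOf_symm (hcubic : G.IsRegularOfDegree 3)
    (h : M.IsFacePeriodic c) {d e : G.Dart} (he : M.faceOf e = M.faceOf d.symm) :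
    c e.fst ≠ c (M.facePerm d).snd := by
  obtain ⟨n, rfl⟩ := M.exists_facePerm_pow_eq he.symm
  obtain ⟨h2, h3⟩ := snd_facePerm_ne (M := M) hcubic h.coloring d
  rcases h.exists_lt_three d.symm n with ⟨-, h'⟩ | ⟨-, h'⟩ | ⟨-, h'⟩ <;> rw [h']
  · exact h3.symm
  · exact h2.symm
  -- If `p` precedes the given dart on its face, periodicity gives the tail of `p` the third colour.
  -- The face across continues to another neighbour of the same vertex, whose colour must differ.
  · obtain ⟨p, rfl⟩ := M.facePerm.surjective d
    have hp : c (M.facePerm (M.facePerm p)).snd = c p.symm.snd := by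
      rw [← M.fst_facePerm (M.facePerm (M.facePerm p)), h.periodic]
      rfl
    rw [hp, M.facePerm_apply (SimpleGraph.Dart.symm _),
      SimpleGraph.Dart.symm_symm, M.facePerm_apply p]
    refine h.coloring.snd_ne (d' := p.symm) (M.rot_rot_apply_ne hcubic _) ?_
    rw [M.fst_rot, M.fst_rot]

/-- Any shift not divisible by three would make one end of `e` carry the third colour relative to
`d`, a colour absent from the face across. -/
theorem IsFacePeriodic.color_eq_of_shared (hcubic : G.IsRegularOfDegree 3)
    (h : M.IsFacePeriodic c) {d e : G.Dart} (he : M.faceOf e = M.faceOf d)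
    (he' : M.faceOf e.symm = M.faceOf d.symm) : c e.fst = c d.fst := by
  obtain ⟨n, rfl⟩ := M.exists_facePerm_pow_eq he.symm
  rcases h.exists_lt_three d n with ⟨hn, h'⟩ | ⟨hn, h'⟩ | ⟨hn, h'⟩
  · exact h'
  · refine absurd ?_ (h.color_ne_of_faceOf_symm hcubic he')
    change c ((M.facePerm ^ n) d).snd = _
    rw [← M.fst_facePerm, ← M.fst_facePerm (M.facePerm d), ← Equiv.Perm.mul_apply, ← pow_succ',
      h.color_mod, show (n + 1) % 3 = 2 by omega, pow_two, Equiv.Perm.mul_apply]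
  · refine absurd ?_ (h.color_ne_of_faceOf_symm hcubic ((M.faceOf_facePerm _).trans he'))
    rw [M.fst_facePerm]
    exact h'

theorem IsFacePeriodic.sharedEdgesCongruent (hcubic : G.IsRegularOfDegree 3)
    (h : M.IsFacePeriodic c) : M.SharedEdgesCongruent := by
  have key : ∀ d e : G.Dart, M.faceOf e = M.faceOf d → M.faceOf e.symm = M.faceOf d.symm →
      ∀ step : Equiv.Perm G.Dart, step = M.facePerm ∨ step = M.facePerm⁻¹ →
      ∀ n : ℕ, (step ^ n) d = e → 3 ∣ n := by
    rintro d e he he' step (rfl | rfl) n rfl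
    · exact (h.color_eq_iff hcubic d n).1 (h.color_eq_of_shared hcubic he he')
    · have := h.color_eq_of_shared hcubic he he'
      rw [← h.color_eq_iff hcubic (((M.facePerm⁻¹) ^ n) d), this, ← Equiv.Perm.mul_apply,
        inv_pow, mul_inv_cancel, Equiv.Perm.one_apply]
  rintro F₁ F₂ hF e e' - n₁ n₂ ⟨s₁, hs₁, d₁, rfl, -, rfl, he₁⟩ ⟨s₂, hs₂, d₂, rfl, -, hd, he₂⟩
  have hpow : ∀ s : Equiv.Perm G.Dart, s = M.facePerm ∨ s = M.facePerm⁻¹ →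
      ∀ (n : ℕ) d, M.faceOf ((s ^ n) d) = M.faceOf d := by
    rintro s (rfl | rfl) n d
    · exact M.faceOf_facePerm_pow n d
    · rw [← M.faceOf_facePerm_pow n, ← Equiv.Perm.mul_apply, inv_pow, mul_inv_cancel,
        Equiv.Perm.one_apply]
  have hd₁ := hpow s₁ hs₁ (n₁ + 1) d₁
  have hd₂ := hpow s₂ hs₂ (n₂ + 1) d₂
  -- Different faces traverse a shared edge by opposite darts. Hence `n₁ + 1` and `n₂ + 1` are both
  -- divisible by three.
  have h1 : d₂ = d₁.symm := by
    rcases (SimpleGraph.dart_edge_eq_iff _ _).1 hd with h | h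
    · exact absurd (by rw [h]) hF
    · exact h
  have h2 : (s₂ ^ (n₂ + 1)) d₂ = ((s₁ ^ (n₁ + 1)) d₁).symm := by
    rcases (SimpleGraph.dart_edge_eq_iff _ _).1 (he₂.trans he₁.symm) with h | h
    · exact absurd (by rw [← hd₁, ← hd₂, h]) hF
    · exact h
  have h3 : M.faceOf ((s₁ ^ (n₁ + 1)) d₁).symm = M.faceOf d₁.symm := by
    rw [← h2, hd₂, h1]
  have k1 := key _ _ hd₁ h3 s₁ hs₁ _ rfl
  have k2 := key d₂ _ hd₂ (by rw [h2, h1]; simpa using hd₁) s₂ hs₂ _ rfl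
  unfold Nat.ModEq
  omega

/-- If no edge has the same face on both sides, then a boundary walk enters a vertex only once. -/
theorem eq_of_snd_eq_of_faceOf_eq (hcubic : G.IsRegularOfDegree 3)
    (hM : ∀ d, M.faceOf d.symm ≠ M.faceOf d) {d e : G.Dart} (hsnd : e.snd = d.snd)
    (hF : M.faceOf e = M.faceOf d) : e = d := by
  have hcyc : M.rot.SameCycle d.symm e.symm := M.sameCycle_of_fst_eq _ _ hsnd.symm
  obtain ⟨n, -, hn⟩ := hcyc.exists_pow_eq'
  rw [(M.rot_pow_apply_eq_iff hcubic d.symm n (n % 3)).2 (Nat.mod_modEq n 3).symm] at hn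
  have h3 := (M.rot_pow_apply_eq_iff hcubic d.symm 3 0).2 rfl
  have : n % 3 = 0 ∨ n % 3 = 1 ∨ n % 3 = 2 := by omega
  -- At a cubic vertex, of two different incoming darts one has the other's reversal as its face
  -- successor, so that other edge would have one face on both sides.
  rcases this with h | h | h <;> rw [h] at hn
  · exact ((SimpleGraph.Dart.symm_involutive (G := G)).injective hn).symm
  · refine absurd ?_ (hM e)
    rw [hF, ← hn, pow_one, ← facePerm_apply, faceOf_facePerm]
  · refine absurd ?_ (hM d)
    rw [← hF, ← faceOf_facePerm M e, facePerm_apply, ← hn, ← Equiv.Perm.mul_apply, ← pow_succ', h3]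
    rfl

/-- The face walk starting at `b.symm` meets `v`, then the head of `M.rot b`, and ends at the head
of `b`. It does not return to `v` in between, so this stretch is a detour. -/
theorem reachable_induce_compl_of_rot (hcubic : G.IsRegularOfDegree 3)
    (hM : ∀ d, M.faceOf d.symm ≠ M.faceOf d) (v : V) (b : G.Dart) (hb : b.fst = v)
    (h : b.snd ∈ ({v}ᶜ : Set V)) (h' : (M.rot b).snd ∈ ({v}ᶜ : Set V)) :
    (G.induce ({v}ᶜ : Set V)).Reachable ⟨(M.rot b).snd, h'⟩ ⟨b.snd, h⟩ := by
  set L := Function.minimalPeriod M.facePerm b.symm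
  have hL : (M.facePerm ^ L) b.symm = b.symm :=
    (Equiv.Perm.pow_apply_eq_self_iff_minimalPeriod_dvd _ _ _).2 dvd_rfl
  have hL0 : L ≠ 0 := by
    intro h0
    have := M.faceSize_faceOf b.symm
    rw [show Function.minimalPeriod M.facePerm b.symm = 0 from h0, faceSize,
      Set.ncard_eq_zero] at this
    exact Set.eq_empty_iff_forall_notMem.1 this b.symm rfl
  have hL1 : L ≠ 1 := by
    intro h1
    rw [h1, pow_one, facePerm_apply, SimpleGraph.Dart.symm_symm] at hL
    have := congrArg (fun d : G.Dart => d.fst) hL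
    simp only [M.fst_rot] at this
    exact b.adj.ne this
  have key : ∀ n, n + 2 ≤ L → ∃ hn : ((M.facePerm ^ (n + 2)) b.symm).fst ∈ ({v}ᶜ : Set V),
      (G.induce ({v}ᶜ : Set V)).Reachable ⟨(M.rot b).snd, h'⟩
        ⟨((M.facePerm ^ (n + 2)) b.symm).fst, hn⟩ := by
    intro n
    induction n with
    | zero =>
      intro _
      have : ((M.facePerm ^ (0 + 2)) b.symm).fst = (M.rot b).snd := by
        rw [zero_add, pow_two, Equiv.Perm.mul_apply, fst_facePerm, facePerm_apply,
          SimpleGraph.Dart.symm_symm]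
      refine ⟨this ▸ h', ?_⟩
      simp only [this]
      exact .rfl
    | succ n ih =>
      intro hn
      obtain ⟨h1, h2⟩ := ih (by omega)
      have hsnd : ((M.facePerm ^ (n + 1 + 2)) b.symm).fst =
          ((M.facePerm ^ (n + 2)) b.symm).snd := by
        rw [show n + 1 + 2 = (n + 2) + 1 by ring, pow_succ', Equiv.Perm.mul_apply, fst_facePerm]
      have hne : ((M.facePerm ^ (n + 1 + 2)) b.symm).fst ∈ ({v}ᶜ : Set V) := by
        rintro (hv : _ = v)
        rw [hsnd] at hv
        have := eq_of_snd_eq_of_faceOf_eq hcubic hM (d := b.symm) (hv.trans hb.symm)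
          (M.faceOf_facePerm_pow _ _)
        rw [Equiv.Perm.pow_apply_eq_self_iff_minimalPeriod_dvd] at this
        have := Nat.le_of_dvd (by omega) this
        omega
      refine ⟨hne, h2.trans (SimpleGraph.Adj.reachable ?_)⟩
      change G.Adj _ ((M.facePerm ^ (n + 1 + 2)) b.symm).fst
      rw [hsnd]
      exact SimpleGraph.Dart.adj _
  obtain ⟨h1, h2⟩ := key (L - 2) (by omega)
  have hfst : ((M.facePerm ^ (L - 2 + 2)) b.symm).fst = b.snd := by
    rw [Nat.sub_add_cancel (by omega), hL]
    rfl
  simp only [hfst] at h2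
  exact h2

/-- A walk to `v` first reaches a neighbour of `v`, and the face detours link all these neighbours.
-/
theorem isBiconnected_of_faceOf_symm_ne (hconn : G.Connected) (hcubic : G.IsRegularOfDegree 3)
    (hM : ∀ d, M.faceOf d.symm ≠ M.faceOf d) : IsBiconnected G := by
  classical
  refine ⟨?_, hconn, fun v => ?_⟩
  · obtain ⟨v⟩ := hconn.nonempty
    rw [← hcubic v, ← G.card_neighborSet_eq_degree, ← Nat.card_eq_fintype_card]
    exact Nat.card_le_card_of_injective _ Subtype.val_injective
  have hmem : ∀ b : G.Dart, b.fst = v → b.snd ∈ ({v}ᶜ : Set V) := by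
    rintro b rfl
    exact b.adj.ne.symm
  have hrot : ∀ (n : ℕ) (b : G.Dart) (hb : b.fst = v) (hb' : ((M.rot ^ n) b).fst = v),
      (G.induce ({v}ᶜ : Set V)).Reachable ⟨_, hmem b hb⟩ ⟨_, hmem _ hb'⟩ := by
    intro n
    induction n with
    | zero => intro b _ _; exact .rfl
    | succ n ih =>
      intro b hb hb'
      have hb1 : (M.rot b).fst = v := by rw [M.fst_rot, hb]
      simp only [pow_succ, Equiv.Perm.mul_apply] at hb' ⊢
      exact (reachable_induce_compl_of_rot hcubic hM v b hb (hmem b hb) (hmem _ hb1)).symm.trans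
        (ih _ hb1 hb')
  have hdart : ∀ (b b' : G.Dart) (hb : b.fst = v) (hb' : b'.fst = v),
      (G.induce ({v}ᶜ : Set V)).Reachable ⟨_, hmem b hb⟩ ⟨_, hmem b' hb'⟩ := by
    intro b b' hb hb'
    obtain ⟨n, -, rfl⟩ := (M.sameCycle_of_fst_eq b b' (hb.trans hb'.symm)).exists_pow_eq'
    exact hrot n b hb hb'
  have hwalk : ∀ (u w : V) (_ : G.Walk u w) (_ : w = v) (hu : u ∈ ({v}ᶜ : Set V)),
      ∃ (b : G.Dart) (hb : b.fst = v),
        (G.induce ({v}ᶜ : Set V)).Reachable ⟨u, hu⟩ ⟨_, hmem b hb⟩ := by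
    intro u w p
    induction p with
    | nil => intro hw hu; exact absurd hw hu
    | @cons u x w hux p ih =>
      intro hw hu
      by_cases hx : x = v
      · subst hx
        exact ⟨⟨(x, u), hux.symm⟩, rfl, .rfl⟩
      · obtain ⟨b, hb, hr⟩ := ih hw hx
        refine ⟨b, hb, .trans (SimpleGraph.Adj.reachable ?_) hr⟩
        exact hux
  obtain ⟨w, hw⟩ : ∃ w, G.Adj v w := by
    rw [← SimpleGraph.degree_pos_iff_exists_adj, hcubic v]
    norm_num
  refine { preconnected := ?_, nonempty := ⟨⟨w, hw.ne.symm⟩⟩ }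
  rintro ⟨x, hx⟩ ⟨y, hy⟩
  obtain ⟨p⟩ := hconn.preconnected x v
  obtain ⟨q⟩ := hconn.preconnected y v
  obtain ⟨b, hb, h1⟩ := hwalk x v p rfl hx
  obtain ⟨b', hb', h2⟩ := hwalk y v q rfl hy
  exact (h1.trans (hdart b b' hb hb')).trans h2.symm

end Necessity

theorem IsFacePeriodic.comp {M : RotationSystem G} {C C' : Type*} {c : V → C}
    (h : M.IsFacePeriodic c) {φ : C → C'} (hφ : Function.Injective φ) :
    M.IsFacePeriodic (φ ∘ c) where
  coloring v := hφ.comp_injOn (h.coloring v)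
  periodic d := congrArg φ (h.periodic d)

/-! ### From divisible face sizes to a colouring. -/

section Sufficiency

theorem faceSum_one (M : RotationSystem G) [Fintype G.Dart] {k : Type*} [Field k] (F : M.Face) :
    M.faceSum k 1 F = M.faceSize F := by
  classical
  simp only [faceSum, LinearMap.coe_mk, AddHom.coe_mk, Pi.one_apply]
  rw [Finset.sum_boole, faceSize, Set.ncard_eq_toFinset_card']
  congr 2
  ext d
  simp

/-- The nonzero vectors of the plane over the field with two elements. -/
def nonzeroVector (i : ZMod 3) : ZMod 2 × ZMod 2 :=
  if i = 0 then (1, 0) else if i = 1 then (0, 1) else (1, 1)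

theorem nonzeroVector_injective : Function.Injective nonzeroVector := by
  unfold Function.Injective
  decide

theorem nonzeroVector_ne_zero : ∀ i, nonzeroVector i ≠ 0 := by decide

theorem nonzeroVector_add : ∀ i,
    nonzeroVector i + nonzeroVector (i + 1) + nonzeroVector (i + 1 + 1) = 0 := by decide

theorem _root_.PlaneEmbedding.exists_vector_coloring [Finite V] (M : PlaneEmbedding G) (hconn : G.Connected)
    (h : G.Dart → ZMod 3) (hrot : ∀ d, h (M.rot d) = h d + 1) (hsymm : ∀ d, h d.symm = h d) :
    ∃ c : V → ZMod 2 × ZMod 2, ∀ d : G.Dart, c d.snd = c d.fst + nonzeroVector (h d) := by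
  have := Fintype.ofFinite G.Dart
  have : Fact (Nat.Prime 2) := ⟨Nat.prime_two⟩
  have hface : ∀ d, h (M.facePerm d) = h d + 1 := fun d => by rw [facePerm_apply, hrot, hsymm]
  have key : ∀ π : ZMod 2 × ZMod 2 →+ ZMod 2,
      ∃ p : V → ZMod 2, ∀ d : G.Dart, π (nonzeroVector (h d)) = p d.snd - p d.fst := by
    intro π
    refine M.exists_potential hconn (fun d => π (nonzeroVector (h d)))
      (fun d => by rw [hsymm, ZModModule.neg_eq_self]) ?_
    set x : G.Dart → ZMod 2 := fun d => π (nonzeroVector (h d)) with hx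
    have h1 := M.faceSum_comp_facePerm x
    have h2 := M.faceSum_comp_facePerm fun d => x (M.facePerm d)
    -- Labels increase by one along faces, so three consecutive values run over all nonzero vectors
    -- and cancel. Each face sum `S` thus satisfies `3S = 0`, which is `S = 0` in characteristic
    -- two.
    have h3 : x + (fun d => x (M.facePerm d)) + (fun d => x (M.facePerm (M.facePerm d))) = 0 := by
      ext d
      simp only [hx, Pi.add_apply, hface, ← map_add, nonzeroVector_add, map_zero, Pi.zero_apply]
    have h4 := congrArg (M.faceSum (ZMod 2)) h3
    rw [map_add, map_add, h2, h1, map_zero, ZModModule.add_self, zero_add] at h4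
    exact h4
  obtain ⟨p, hp⟩ := key (AddMonoidHom.fst _ _)
  obtain ⟨q, hq⟩ := key (AddMonoidHom.snd _ _)
  refine ⟨fun v => (p v, q v), fun d => Prod.ext ?_ ?_⟩
  · exact sub_eq_iff_eq_add'.1 (hp d).symm
  · exact sub_eq_iff_eq_add'.1 (hq d).symm

variable [Finite V] [G.LocallyFinite]

/-- The label counts rotations, modulo three, from a base dart chosen at each vertex. -/
theorem exists_rot_labelling (M : RotationSystem G) (hcubic : G.IsRegularOfDegree 3) :
    ∃ h : G.Dart → ZMod 3, ∀ d, h (M.rot d) = h d + 1 := by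
  have hbase : ∀ v, ∃ b : G.Dart, b.fst = v := by
    intro v
    obtain ⟨w, hw⟩ : ∃ w, G.Adj v w := by
      rw [← SimpleGraph.degree_pos_iff_exists_adj, hcubic v]
      norm_num
    exact ⟨⟨(v, w), hw⟩, rfl⟩
  choose b hb using hbase
  have hn : ∀ d : G.Dart, ∃ n : ℕ, (M.rot ^ n) (b d.fst) = d := fun d =>
    have ⟨n, _, hn⟩ := (M.sameCycle_of_fst_eq (b d.fst) d (hb _)).exists_pow_eq'
    ⟨n, hn⟩
  choose n hn using hn
  refine ⟨fun d => n d, fun d => ?_⟩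
  have h1 := hn (M.rot d)
  rw [M.fst_rot] at h1
  have h2 : (M.rot ^ (n d + 1)) (b d.fst) = M.rot d := by
    rw [pow_succ', Equiv.Perm.mul_apply, hn]
  have h3 := (M.rot_pow_apply_eq_iff hcubic _ _ _).1 (h1.trans h2.symm)
  have h4 := (ZMod.natCast_eq_natCast_iff _ _ _).2 h3
  simpa using h4

/-- On a sphere with all face sizes divisible by three, the edges can be labelled by `ZMod 3`
increasingly in the order of the rotation at every vertex. -/
theorem _root_.PlaneEmbedding.exists_edge_labelling (M : PlaneEmbedding G) (hconn : G.Connected)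
    (hcubic : G.IsRegularOfDegree 3) (hsize : ∀ F, 3 ∣ M.faceSize F) :
    ∃ h : G.Dart → ZMod 3, (∀ d, h (M.rot d) = h d + 1) ∧ ∀ d, h d.symm = h d := by
  have := Fintype.ofFinite G.Dart
  have : Fact (Nat.Prime 3) := ⟨Nat.prime_three⟩
  obtain ⟨h, hrot⟩ := M.exists_rot_labelling hcubic
  obtain ⟨p, hp⟩ := M.exists_potential hconn (fun d => h d.symm - h d)
    (fun d => by rw [SimpleGraph.Dart.symm_symm, neg_sub]) (by
      -- The mismatch across an edge is a difference along the face walk minus one, so its face sum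
      -- is minus the face size.
      have : (fun d => h d.symm - h d) = (fun d => h (M.facePerm d)) - h - 1 := by
        ext d
        simp only [Pi.sub_apply, Pi.one_apply, facePerm_apply, hrot]
        ring
      rw [this, map_sub, map_sub, faceSum_comp_facePerm, sub_self, zero_sub, neg_eq_zero]
      ext F
      rw [faceSum_one, Pi.zero_apply, ZMod.natCast_eq_zero_iff]
      exact hsize F)
  -- Rotation fixes the tail, so the shift keeps the increments while cancelling the mismatch.
  refine ⟨fun d => h d - p d.fst, fun d => ?_, fun d => ?_⟩
  · simp only [hrot, M.fst_rot]
    ring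
  · have : h d.symm = h d + (p d.snd - p d.fst) := by rw [← hp]; ring
    change h d.symm - p d.snd = _
    rw [this]
    ring

/-- The three darts at a vertex have distinct labels, hence add distinct nonzero vectors; three
steps along a face add all of them, with sum zero. -/
theorem isFacePeriodic_of_labelling (M : RotationSystem G) (hcubic : G.IsRegularOfDegree 3)
    {h : G.Dart → ZMod 3} (hrot : ∀ d, h (M.rot d) = h d + 1) (hsymm : ∀ d, h d.symm = h d)
    {c : V → ZMod 2 × ZMod 2} (hc : ∀ d : G.Dart, c d.snd = c d.fst + nonzeroVector (h d)) :
    M.IsFacePeriodic c where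
  coloring := by
    have hself : ∀ v w, G.Adj v w → c w ≠ c v := by
      intro v w hvw
      rw [hc ⟨(v, w), hvw⟩]
      simpa using nonzeroVector_ne_zero _
    rintro v x (rfl | hx) y (rfl | hy) hxy
    · rfl
    · exact absurd hxy.symm (hself _ _ hy)
    · exact absurd hxy (hself _ _ hx)
    · rw [hc ⟨(v, x), hx⟩, hc ⟨(v, y), hy⟩] at hxy
      have h1 := nonzeroVector_injective (add_left_cancel hxy)
      obtain ⟨n, -, hn⟩ := (M.sameCycle_of_fst_eq ⟨(v, x), hx⟩ ⟨(v, y), hy⟩ rfl).exists_pow_eq'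
      have hpow : ∀ (n : ℕ) d, h ((M.rot ^ n) d) = h d + n := by
        intro n d
        induction n with
        | zero => simp
        | succ n ih =>
          rw [pow_succ', Equiv.Perm.mul_apply, hrot, ih]
          push_cast
          ring
      rw [← hn, hpow, left_eq_add, ZMod.natCast_eq_zero_iff] at h1
      rw [(M.rot_pow_apply_eq_iff hcubic _ n 0).2 (Nat.modEq_zero_iff_dvd.2 h1)] at hn
      exact congrArg (fun d : G.Dart => d.snd) hn
  periodic d := by
    have hface : ∀ d, h (M.facePerm d) = h d + 1 := fun d => by rw [facePerm_apply, hrot, hsymm]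
    rw [fst_facePerm, hc, fst_facePerm, hc, fst_facePerm, hc, hface, hface, hface, add_assoc, add_assoc,
      ← add_assoc (nonzeroVector _), nonzeroVector_add, add_zero]

theorem IsFacePeriodic.ncard_image_faceVertices {M : RotationSystem G} {C : Type*} {c : V → C}
    (hcubic : G.IsRegularOfDegree 3) (h : M.IsFacePeriodic c) (F : M.Face) :
    (c '' M.faceVertices F).ncard = 3 := by
  obtain ⟨d, rfl⟩ := M.exists_faceOf_eq F
  obtain ⟨h2, h3⟩ := snd_facePerm_ne (M := M) hcubic h.coloring d
  have h1 := h.coloring.ne_of_adj d.adj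
  refine Set.ncard_eq_three.2 ⟨c d.fst, c d.snd, c (M.facePerm d).snd, h1, h2.symm, h3.symm, ?_⟩
  ext a
  constructor
  · rintro ⟨_, ⟨e, he, rfl⟩, rfl⟩
    obtain ⟨n, rfl⟩ := M.exists_facePerm_pow_eq he.symm
    rcases h.exists_lt_three d n with ⟨-, h'⟩ | ⟨-, h'⟩ | ⟨-, h'⟩ <;> rw [h'] <;> simp
  · rintro (rfl | rfl | rfl)
    · exact ⟨_, ⟨d, rfl, rfl⟩, rfl⟩
    · exact ⟨_, ⟨M.facePerm d, M.faceOf_facePerm d, M.fst_facePerm d⟩, rfl⟩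
    · exact ⟨_, ⟨M.facePerm (M.facePerm d), by rw [faceOf_facePerm, faceOf_facePerm],
        M.fst_facePerm _⟩, rfl⟩

end Sufficiency

end RotationSystem

theorem theorem5p1 {V : Type*} [Finite V] (G : SimpleGraph V) [G.LocallyFinite]
    (hconn : G.Connected) (hcubic : G.IsRegularOfDegree 3) (M : PlaneEmbedding G) :
    (∃ c : V → Fin 4, IsDistanceTwoColoring G c ∧
        ∀ F : M.Face, (c '' M.faceVertices F).ncard = 3) ↔
      (∀ F : M.Face, 3 ∣ M.faceSize F) ∧ IsBiconnected G ∧ M.SharedEdgesCongruent := by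
  constructor
  · rintro ⟨c, hc, h3⟩
    have h : M.IsFacePeriodic c := ⟨hc, M.color_fst_facePerm_pow_three hcubic hc h3⟩
    exact ⟨h.three_dvd_faceSize hcubic,
      RotationSystem.isBiconnected_of_faceOf_symm_ne hconn hcubic (h.faceOf_symm_ne hcubic),
      h.sharedEdgesCongruent hcubic⟩
  · rintro ⟨hsize, -, -⟩
    obtain ⟨h, hrot, hsymm⟩ := M.exists_edge_labelling hconn hcubic hsize
    obtain ⟨c, hc⟩ := M.exists_vector_coloring hconn h hrot hsymm
    have e : ZMod 2 × ZMod 2 ≃ Fin 4 := Fintype.equivOfCardEq rfl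
    have hper := (M.isFacePeriodic_of_labelling hcubic hrot hsymm hc).comp e.injective
    exact ⟨e ∘ c, hper.coloring, hper.ncard_image_faceVertices hcubic⟩
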